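/- There exists a convex hyperbolic dodecahedron $C\subset\mathbb{H}^3$, i.e. a compact convex polyhedron with nonempty interior in three-dimensional hyperbolic space that has the combinatorial type of the regular dodecahedron, such that every (two-dimensional) face of $C$ is a regular hyperbolic pentagon (all five sides have equal length) with all interior angles equal to $\pi/2$, and such that the dihedral angle of $C$ between any two distinct faces sharing an edge is $\pi/2$. -/

import Mathlib

noncomputable section

namespace Hyp

/-- The Lorentzian form `-x₀y₀ + x₁y₁ + x₂y₂ + x₃y₃` on `ℝ⁴`. -/
def form (x y : Fin 4 → ℝ) : ℝ :=
  -(x 0 * y 0) + x 1 * y 1 + x 2 * y 2 + x 3 * y 3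

/-- Hyperbolic 3-space in the hyperboloid model, with the topology induced from `ℝ⁴`. -/
abbrev H3 : Type := {x : Fin 4 → ℝ // form x x = -1 ∧ 0 < x 0}

/-- The hyperbolic distance, `cosh (hdist x y) = -form x y`. -/
def hdist (x y : H3) : ℝ := Real.arcosh (-form x.1 y.1)

/-- The component of `y` tangent to the hyperboloid at `x`: it is orthogonal to `x`, and it is
a positive multiple of the initial velocity of the geodesic from `x` to `y` when `y ≠ x`. -/
def direction (x y : H3) : Fin 4 → ℝ := y.1 + form x.1 y.1 • x.1

/-- The angle between two spacelike vectors that span a spacelike plane. -/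
def vectorAngle (u v : Fin 4 → ℝ) : ℝ :=
  Real.arccos (form u v / (√(form u u) * √(form v v)))

/-- The angle at `x` between the geodesic segments from `x` to `y` and from `x` to `z`. -/
def angleAt (y x z : H3) : ℝ := vectorAngle (direction x y) (direction x z)

/-- The geodesic segment between `x` and `y`. Geodesics of the hyperboloid are its intersections
with linear planes, so the segment consists of the points of the hyperboloid which are
combinations of `x` and `y` with nonnegative coefficients. -/
def segment (x y : H3) : Set H3 :=
  {z | ∃ a b : ℝ, 0 ≤ a ∧ 0 ≤ b ∧ z.1 = a • x.1 + b • y.1}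

/-- Geodesic convexity. -/
def IsConvex (S : Set H3) : Prop := ∀ x ∈ S, ∀ y ∈ S, segment x y ⊆ S

/-- The geodesic convex hull. -/
def hull (S : Set H3) : Set H3 := ⋂₀ {T | IsConvex T ∧ S ⊆ T}

/-- The totally geodesic plane with normal vector `n` (meaningful for spacelike `n`). -/
def plane (n : Fin 4 → ℝ) : Set H3 := {x | form n x.1 = 0}

/-- The closed half-space bounded by `plane n` with outer normal `n`
(meaningful for spacelike `n`). -/
def halfSpace (n : Fin 4 → ℝ) : Set H3 := {x | form n x.1 ≤ 0}

/-- A compact convex polyhedron: a finite intersection of closed half-spaces which is compact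
and has nonempty interior. -/
structure IsConvexPolyhedron (C : Set H3) : Prop where
  isConvex : IsConvex C
  isCompact : IsCompact C
  nonempty_interior : (interior C).Nonempty
  eq_inter : ∃ N : Set (Fin 4 → ℝ), N.Finite ∧ (∀ n ∈ N, 0 < form n n) ∧ C = ⋂ n ∈ N, halfSpace n

/-- `F` is cut out on `C` by the plane with spacelike normal `n`, and `C` lies on the side of that
plane away from `n`. -/
def IsOuterNormal (C F : Set H3) (n : Fin 4 → ℝ) : Prop :=
  0 < form n n ∧ C ⊆ halfSpace n ∧ F = C ∩ plane n

/-- `F` is a `k`-dimensional face of `C`: it is cut out by a supporting plane, and the smallest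
totally geodesic subspace containing it (the trace of its linear span) has dimension `k`. -/
def IsFace (k : ℕ) (C F : Set H3) : Prop :=
  (∃ n, IsOuterNormal C F n) ∧
    Module.finrank ℝ (Submodule.span ℝ ((fun x : H3 => x.1) '' F)) = k + 1

/-- `v` is a vertex of `C`. -/
def IsVertex (C : Set H3) (v : H3) : Prop := IsFace 0 C {v}

/-- `F` and `G` are cut out on `C` by supporting planes whose interior dihedral angle (the
supplement of the angle between the outer normals) is `θ`. -/
def HasDihedralAngle (C F G : Set H3) (θ : ℝ) : Prop :=
  ∃ n m, IsOuterNormal C F n ∧ IsOuterNormal C G m ∧ Real.pi - vectorAngle n m = θ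

/-- `F` is a regular convex geodesic `k`-gon with interior angles `θ`: it lies in a totally
geodesic plane and is the convex hull of `k ≥ 3` distinct points `p i` in cyclic order, such that
the sides of `F` are the segments between consecutive points, all sides have the same length, and
all interior angles are `θ`. -/
def IsRegularPolygon (k : ℕ) (θ : ℝ) (F : Set H3) : Prop :=
  3 ≤ k ∧ ∃ p : ZMod k → H3, Function.Injective p ∧
    (∃ n, 0 < form n n ∧ F ⊆ plane n) ∧
    F = hull (Set.range p) ∧
    (∀ i, IsFace 1 F (segment (p i) (p (i + 1)))) ∧
    (∃ s : ℝ, ∀ i, hdist (p i) (p (i + 1)) = s) ∧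
    ∀ i, angleAt (p (i - 1)) (p i) (p (i + 1)) = θ

/-- The 20 vertices of a Euclidean regular dodecahedron: `(±1, ±1, ±1)` and the cyclic
permutations of `(0, ±φ, ±φ⁻¹)`, where `φ` is the golden ratio. -/
def euclVertices : Set (Fin 3 → ℝ) :=
  {v | (∀ i, |v i| = 1) ∨
    ∃ i, v i = 0 ∧ |v (i + 1)| = Real.goldenRatio ∧ |v (i + 2)| = Real.goldenRatio⁻¹}

/-- Normal vectors of the 12 faces of that dodecahedron: the cyclic permutations of
`(0, ±1, ±φ)`. The face with normal `n` lies in the plane `n ⬝ᵥ x = φ ^ 2`. -/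
def euclNormals : Set (Fin 3 → ℝ) :=
  {n | ∃ i, n i = 0 ∧ |n (i + 1)| = 1 ∧ |n (i + 2)| = Real.goldenRatio}

/-- `C` is a compact convex polyhedron of the combinatorial type of the regular dodecahedron:
there are bijections between the vertices and between the two-dimensional faces which preserve
and reflect the incidence of vertices and faces. -/
def IsConvexDodecahedron (C : Set H3) : Prop :=
  IsConvexPolyhedron C ∧
    ∃ (e : euclVertices ≃ {v : H3 // IsVertex C v}) (f : euclNormals ≃ {F : Set H3 // IsFace 2 C F}),
      ∀ v n, (e v).1 ∈ (f n).1 ↔ n.1 ⬝ᵥ v.1 = Real.goldenRatio ^ 2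

end Hyp

end

noncomputable section

namespace Hyp

open Real Topology Filter

local notation "φ" => Real.goldenRatio

/-! ### The Euclidean dodecahedron -/

/-! In the projective (Klein) model a regular Euclidean dodecahedron centred at the origin is also a
regular hyperbolic one, and its dihedral angle depends on its size. For the outer normals `(√φ, n)`
the Lorentz product is `n ⬝ᵥ m - φ`. Adjacent Euclidean normals satisfy `n ⬝ᵥ m = φ`, so the entry
`√φ` is exactly the size that makes adjacent faces orthogonal. The polyhedron is then the Euclidean
one shrunk by `φ ^ (3 / 2)`, and it fits in the unit ball because the squared circumradius `3` is
less than `φ ^ 3`.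

`coneMap` carries the cone over the Euclidean dodecahedron to the cone over the hyperbolic one, so
all incidences and lengths reduce to dot products, and the symmetries reduce these to one face. The
sides have hyperbolic cosine `φ`, and the right angles of the pentagons come from `1` being the dot
product of second neighbours.

The main geometric input is `mem_cone_of_forall_dotProduct_le`: the cone defined by the face
inequalities is generated by the vertices. It yields the bounding ball, hence compactness, and with
`mem_pointedConeHull_of_form_eq_zero` it identifies vertices, sides and faces as hulls. That there
are no further two-dimensional faces is `exists_eq_facet`; that distinct faces with a common point
are adjacent is `dotProduct_eq_of_mem_facet`. -/

theorem inv_goldenRatio_eq : φ⁻¹ = φ - 1 := by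
  rw [inv_goldenRatio, ← one_sub_goldenConj]; ring

theorem goldenRatio_gt : 8 / 5 < φ := by
  nlinarith [goldenRatio_sq, goldenRatio_pos]

theorem dotProduct_fin_three (x y : Fin 3 → ℝ) :
    x ⬝ᵥ y = x 0 * y 0 + x 1 * y 1 + x 2 * y 2 := by
  simp [dotProduct, Fin.sum_univ_three]

theorem mem_euclVertices_iff (v : Fin 3 → ℝ) :
    v ∈ euclVertices ↔ (|v 0| = 1 ∧ |v 1| = 1 ∧ |v 2| = 1) ∨
      (v 0 = 0 ∧ |v 1| = φ ∧ |v 2| = φ - 1) ∨ (v 1 = 0 ∧ |v 2| = φ ∧ |v 0| = φ - 1) ∨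
      (v 2 = 0 ∧ |v 0| = φ ∧ |v 1| = φ - 1) := by
  simp only [euclVertices, Set.mem_ofPred_eq, inv_goldenRatio_eq]
  constructor
  · rintro (h | ⟨i, h⟩)
    · exact Or.inl ⟨h 0, h 1, h 2⟩
    · fin_cases i
      · exact Or.inr (Or.inl h)
      · exact Or.inr (Or.inr (Or.inl h))
      · exact Or.inr (Or.inr (Or.inr h))
  · rintro (⟨h0, h1, h2⟩ | h | h | h)
    · refine Or.inl fun i => ?_
      fin_cases i <;> assumption
    · exact Or.inr ⟨0, h⟩
    · exact Or.inr ⟨1, h⟩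
    · exact Or.inr ⟨2, h⟩

theorem mem_euclNormals_iff (n : Fin 3 → ℝ) :
    n ∈ euclNormals ↔ (n 0 = 0 ∧ |n 1| = 1 ∧ |n 2| = φ) ∨ (n 1 = 0 ∧ |n 2| = 1 ∧ |n 0| = φ) ∨
      (n 2 = 0 ∧ |n 0| = 1 ∧ |n 1| = φ) := by
  simp only [euclNormals, Set.mem_ofPred_eq]
  constructor
  · rintro ⟨i, h⟩
    fin_cases i
    · exact Or.inl h
    · exact Or.inr (Or.inl h)
    · exact Or.inr (Or.inr h)
  · rintro (h | h | h)
    · exact ⟨0, h⟩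
    · exact ⟨1, h⟩
    · exact ⟨2, h⟩

theorem eq_or_eq_neg_of_abs {a b : ℝ} (h : |a| = b) : a = b ∨ a = -b :=
  (abs_eq (h ▸ abs_nonneg a)).1 h

theorem finite_euclNormals : euclNormals.Finite := by
  have hfin : ({0, 1, -1, φ, -φ} : Set ℝ).Finite := by simp
  refine (Set.Finite.pi' (fun _ : Fin 3 => hfin)).subset fun n hn => ?_
  rw [mem_euclNormals_iff] at hn
  simp only [Set.mem_ofPred_eq, Fin.forall_fin_succ, Set.mem_insert_iff, Set.mem_singleton_iff]
  rcases hn with ⟨h, h', h''⟩ | ⟨h, h', h''⟩ | ⟨h, h', h''⟩ <;>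
    have h' := eq_or_eq_neg_of_abs h' <;> have h'' := eq_or_eq_neg_of_abs h'' <;>
    refine ⟨?_, ?_, ?_, fun i => i.elim0⟩ <;>
    tauto

theorem dotProduct_self_of_mem_euclVertices {v : Fin 3 → ℝ} (hv : v ∈ euclVertices) :
    v ⬝ᵥ v = 3 := by
  rw [mem_euclVertices_iff] at hv
  rw [dotProduct_fin_three, ← abs_mul_abs_self (v 0), ← abs_mul_abs_self (v 1),
    ← abs_mul_abs_self (v 2)]
  rcases hv with ⟨h, h', h''⟩ | ⟨h, h', h''⟩ | ⟨h, h', h''⟩ | ⟨h, h', h''⟩ <;>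
    rw [h, h', h''] <;> try rw [abs_zero]
  all_goals linarith [goldenRatio_sq]

theorem dotProduct_self_of_mem_euclNormals {n : Fin 3 → ℝ} (hn : n ∈ euclNormals) :
    n ⬝ᵥ n = φ + 2 := by
  rw [mem_euclNormals_iff] at hn
  rw [dotProduct_fin_three, ← abs_mul_abs_self (n 0), ← abs_mul_abs_self (n 1),
    ← abs_mul_abs_self (n 2)]
  rcases hn with ⟨h, h', h''⟩ | ⟨h, h', h''⟩ | ⟨h, h', h''⟩ <;>
    rw [h, h', h''] <;> try rw [abs_zero]
  all_goals linarith [goldenRatio_sq]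

theorem neg_mem_euclVertices {v : Fin 3 → ℝ} (hv : v ∈ euclVertices) : -v ∈ euclVertices := by
  simpa [euclVertices] using hv

theorem neg_mem_euclNormals {n : Fin 3 → ℝ} (hn : n ∈ euclNormals) : -n ∈ euclNormals := by
  simpa [euclNormals] using hn

/-! ### Symmetries -/

/-- The linear map which permutes the coordinates cyclically and then multiplies them by signs. -/
def signedShift (ε : Fin 3 → ℝ) (i : Fin 3) : (Fin 3 → ℝ) →ₗ[ℝ] (Fin 3 → ℝ) where
  toFun y j := ε j * y (j - i)
  map_add' x y := by ext j; simp [mul_add]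
  map_smul' c y := by ext j; simp [mul_left_comm]

theorem signedShift_apply (ε : Fin 3 → ℝ) (i : Fin 3) (y : Fin 3 → ℝ) (j : Fin 3) :
    signedShift ε i y j = ε j * y (j - i) := rfl

variable {ε : Fin 3 → ℝ}

theorem signedShift_signedShift_inverse (hε : ∀ j, |ε j| = 1) (i : Fin 3) (y : Fin 3 → ℝ) :
    signedShift ε i (signedShift (fun j => ε (j + i)) (-i) y) = y := by
  ext j
  have h1 : j - i + i = j := by simp
  have h2 : j - i - -i = j := by simp
  have h3 : ε j * ε j = 1 := by rw [← abs_mul_abs_self, hε, one_mul]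
  simp only [signedShift_apply, h1, h2]
  rw [← mul_assoc, h3, one_mul]

theorem dotProduct_signedShift (hε : ∀ j, |ε j| = 1) (i : Fin 3) (x y : Fin 3 → ℝ) :
    signedShift ε i x ⬝ᵥ signedShift ε i y = x ⬝ᵥ y := by
  have h (j : Fin 3) : ε j * ε j = 1 := by rw [← abs_mul_abs_self, hε, one_mul]
  have h' : signedShift ε i x ⬝ᵥ signedShift ε i y = ∑ j, x (j - i) * y (j - i) := by
    refine Finset.sum_congr rfl fun j _ => ?_
    simp only [signedShift_apply]
    linear_combination (x (j - i) * y (j - i)) * h j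
  rw [h']
  exact Equiv.sum_comp (Equiv.subRight i) (fun j => x j * y j)

theorem signedShift_mem_euclVertices (hε : ∀ j, |ε j| = 1) (i : Fin 3) {v : Fin 3 → ℝ}
    (hv : v ∈ euclVertices) : signedShift ε i v ∈ euclVertices := by
  have h0 : ∀ k i : Fin 3, k + i - i = k := by decide
  have h1 : ∀ k i : Fin 3, k + i + 1 - i = k + 1 := by decide
  have h2 : ∀ k i : Fin 3, k + i + 2 - i = k + 2 := by decide
  rcases hv with h | ⟨k, h⟩
  · exact Or.inl fun j => by rw [signedShift_apply, abs_mul, hε, one_mul, h]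
  · refine Or.inr ⟨k + i, ?_⟩
    simpa only [signedShift_apply, abs_mul, hε, one_mul, h0, h1, h2, h.1, mul_zero, true_and]
      using h.2

theorem signedShift_mem_euclNormals (hε : ∀ j, |ε j| = 1) (i : Fin 3) {n : Fin 3 → ℝ}
    (hn : n ∈ euclNormals) : signedShift ε i n ∈ euclNormals := by
  have h0 : ∀ k i : Fin 3, k + i - i = k := by decide
  have h1 : ∀ k i : Fin 3, k + i + 1 - i = k + 1 := by decide
  have h2 : ∀ k i : Fin 3, k + i + 2 - i = k + 2 := by decide
  obtain ⟨k, h⟩ := hn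
  refine ⟨k + i, ?_⟩
  simpa only [signedShift_apply, abs_mul, hε, one_mul, h0, h1, h2, h.1, mul_zero, true_and]
    using h.2

/-- The normal vector `(0, 1, φ)`, to whose face the others are reduced by symmetry. -/
def baseNormal : Fin 3 → ℝ := ![0, 1, φ]

theorem exists_abs_eq_one_mul_abs (a : ℝ) : ∃ s : ℝ, |s| = 1 ∧ a = s * |a| := by
  rcases abs_cases a with ⟨h, -⟩ | ⟨h, -⟩
  · exact ⟨1, by simp, by rw [h, one_mul]⟩
  · exact ⟨-1, by simp, by rw [h]; ring⟩

/-- The shift is the index of the zero coordinate and the signs are those of the coordinates of `n`.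
This is the transitivity on faces that reduces later statements to `baseNormal`. -/
theorem exists_signedShift_baseNormal {n : Fin 3 → ℝ} (hn : n ∈ euclNormals) :
    ∃ ε i, (∀ j, |ε j| = 1) ∧ n = signedShift ε i baseNormal := by
  choose s hs hs' using exists_abs_eq_one_mul_abs
  obtain ⟨i, h0, h1, h2⟩ := hn
  have key : ∀ k, |n (i + k)| = baseNormal k := by
    intro k
    fin_cases k
    · simp [baseNormal, h0]
    · exact h1
    · exact h2
  refine ⟨fun j => s (n j), i, fun j => hs _, ?_⟩
  ext j
  rw [signedShift_apply, ← key, add_sub_cancel, ← hs']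

theorem dotProduct_baseNormal (v : Fin 3 → ℝ) : baseNormal ⬝ᵥ v = v 1 + φ * v 2 := by
  rw [dotProduct_fin_three]
  change 0 * v 0 + 1 * v 1 + φ * v 2 = _
  ring

theorem baseNormal_mem : baseNormal ∈ euclNormals := by
  rw [mem_euclNormals_iff]
  simp [baseNormal, abs_of_pos goldenRatio_pos]

theorem dotProduct_signedShift_left (hε : ∀ j, |ε j| = 1) (i : Fin 3) (x y : Fin 3 → ℝ) :
    signedShift ε i x ⬝ᵥ y = x ⬝ᵥ signedShift (fun j => ε (j + i)) (-i) y := by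
  rw [← dotProduct_signedShift hε i x, signedShift_signedShift_inverse hε]

theorem dotProduct_le_of_mem {n v : Fin 3 → ℝ} (hn : n ∈ euclNormals) (hv : v ∈ euclVertices) :
    n ⬝ᵥ v ≤ φ ^ 2 := by
  obtain ⟨ε, i, hε, rfl⟩ := exists_signedShift_baseNormal hn
  rw [dotProduct_signedShift_left hε, dotProduct_baseNormal]
  have := signedShift_mem_euclVertices (fun j => hε (j + i)) (-i) hv
  generalize signedShift _ _ v = w at this
  have hφ := goldenRatio_sq
  have hφ' := goldenRatio_gt
  rcases (mem_euclVertices_iff w).1 this with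
    ⟨-, h1, h2⟩ | ⟨-, h1, h2⟩ | ⟨h1, h2, -⟩ | ⟨h2, -, h1⟩
  · nlinarith [le_abs_self (w 1), le_abs_self (w 2)]
  · nlinarith [le_abs_self (w 1), le_abs_self (w 2)]
  · nlinarith [le_abs_self (w 2)]
  · nlinarith [le_abs_self (w 1)]

/-- The three cases are equal faces, adjacent faces, and faces that do not meet (the last including
opposite ones). -/
theorem dotProduct_cases {n m : Fin 3 → ℝ} (hn : n ∈ euclNormals) (hm : m ∈ euclNormals) :
    n ⬝ᵥ m = φ + 2 ∨ n ⬝ᵥ m = φ ∨ n ⬝ᵥ m ≤ -φ := by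
  obtain ⟨ε, i, hε, rfl⟩ := exists_signedShift_baseNormal hn
  rw [dotProduct_signedShift_left hε, dotProduct_baseNormal]
  have := signedShift_mem_euclNormals (fun j => hε (j + i)) (-i) hm
  generalize signedShift _ _ m = w at this
  have hφ := goldenRatio_sq
  have hφ' := goldenRatio_gt
  rcases (mem_euclNormals_iff w).1 this with ⟨-, h1, h2⟩ | ⟨h1, h2, -⟩ | ⟨h2, -, h1⟩
  · rcases eq_or_eq_neg_of_abs h1 with h1 | h1 <;> rcases eq_or_eq_neg_of_abs h2 with h2 | h2 <;>
      rw [h1, h2]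
    · left; linarith
    · right; right; linarith
    · right; left; linarith
    · right; right; linarith
  · rcases eq_or_eq_neg_of_abs h2 with h2 | h2 <;> rw [h1, h2]
    · right; left; ring
    · right; right; linarith
  · rcases eq_or_eq_neg_of_abs h1 with h1 | h1 <;> rw [h1, h2]
    · right; left; ring
    · right; right; linarith

theorem eq_of_dotProduct_eq {n m : Fin 3 → ℝ} {c : ℝ} (hn : n ⬝ᵥ n = c) (hm : m ⬝ᵥ m = c)
    (h : n ⬝ᵥ m = c) : n = m := by
  rw [← sub_eq_zero, ← dotProduct_self_eq_zero]
  rw [sub_dotProduct, dotProduct_sub, dotProduct_sub, hn, hm, dotProduct_comm m, h]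
  ring

/-! ### The pentagons -/

/-- The vertices of the face with normal `(0, 1, φ)` in cyclic order. -/
def basePentagon : ZMod 5 → Fin 3 → ℝ :=
  (![![1, 1, 1], ![0, φ, φ - 1], ![-1, 1, 1], ![1 - φ, 0, φ], ![φ - 1, 0, φ]] :
    Fin 5 → Fin 3 → ℝ)

/-- The normal vectors of the faces adjacent to the face with normal `(0, 1, φ)`; the `i`-th one
meets it in the side from the `i`-th to the `i + 1`-st vertex. -/
def baseNeighbour : ZMod 5 → Fin 3 → ℝ :=
  (![![1, φ, 0], ![-1, φ, 0], ![-φ, 0, 1], ![0, -1, φ], ![φ, 0, 1]] : Fin 5 → Fin 3 → ℝ)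

theorem forall_zmod_five {P : ZMod 5 → Prop} (h0 : P 0) (h1 : P 1) (h2 : P 2) (h3 : P 3)
    (h4 : P 4) : ∀ i, P i := by
  intro i
  fin_cases i
  exacts [h0, h1, h2, h3, h4]

theorem basePentagon_mem (i : ZMod 5) : basePentagon i ∈ euclVertices := by
  have h := abs_of_pos goldenRatio_pos
  have h' := abs_of_pos (sub_pos.2 one_lt_goldenRatio)
  have h'' : |1 - φ| = φ - 1 := by rw [abs_sub_comm, h']
  rw [mem_euclVertices_iff]
  revert i
  apply forall_zmod_five
  · left; change |(1:ℝ)| = 1 ∧ |(1:ℝ)| = 1 ∧ |(1:ℝ)| = 1; simp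
  · right; left; exact ⟨rfl, h, h'⟩
  · left; change |(-1:ℝ)| = 1 ∧ |(1:ℝ)| = 1 ∧ |(1:ℝ)| = 1; simp
  · right; right; left; exact ⟨rfl, h, h''⟩
  · right; right; left; exact ⟨rfl, h, h'⟩

theorem baseNeighbour_mem (i : ZMod 5) : baseNeighbour i ∈ euclNormals := by
  have h := abs_of_pos goldenRatio_pos
  have h' : |-φ| = φ := by rw [abs_neg, h]
  have h1 : |(1 : ℝ)| = 1 := abs_one
  have h1' : |(-1 : ℝ)| = 1 := by simp
  rw [mem_euclNormals_iff]
  revert i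
  apply forall_zmod_five
  · right; right; exact ⟨rfl, h1, h⟩
  · right; right; exact ⟨rfl, h1', h⟩
  · right; left; exact ⟨rfl, h1, h'⟩
  · left; exact ⟨rfl, h1', h⟩
  · right; left; exact ⟨rfl, h1, h⟩

theorem basePentagon_dotProduct_succ (i : ZMod 5) :
    basePentagon i ⬝ᵥ basePentagon (i + 1) = 2 * φ - 1 := by
  have hφ := goldenRatio_sq
  revert i
  apply forall_zmod_five <;> rw [dotProduct_fin_three]
  · change 1 * 0 + 1 * φ + 1 * (φ - 1) = 2 * φ - 1; ring
  · change 0 * (-1) + φ * 1 + (φ - 1) * 1 = 2 * φ - 1; ring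
  · change -1 * (1 - φ) + 1 * 0 + 1 * φ = 2 * φ - 1; ring
  · change (1 - φ) * (φ - 1) + 0 * 0 + φ * φ = 2 * φ - 1; linarith
  · change (φ - 1) * 1 + 0 * 1 + φ * 1 = 2 * φ - 1; ring

theorem basePentagon_dotProduct_pred_succ (i : ZMod 5) :
    basePentagon (i - 1) ⬝ᵥ basePentagon (i + 1) = 1 := by
  have hφ := goldenRatio_sq
  revert i
  apply forall_zmod_five <;> rw [dotProduct_fin_three]
  · change (φ - 1) * 0 + 0 * φ + φ * (φ - 1) = 1; linarith
  · change 1 * (-1) + 1 * 1 + 1 * 1 = (1 : ℝ); norm_num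
  · change 0 * (1 - φ) + φ * 0 + (φ - 1) * φ = 1; linarith
  · change -1 * (φ - 1) + 1 * 0 + 1 * φ = 1; ring
  · change (1 - φ) * 1 + 0 * 1 + φ * 1 = 1; ring

theorem baseNeighbour_dotProduct_eq_iff (i j : ZMod 5) :
    baseNeighbour i ⬝ᵥ basePentagon j = φ ^ 2 ↔ j = i ∨ j = i + 1 := by
  have hφ := goldenRatio_sq
  have hφ' := goldenRatio_gt
  have p0 : basePentagon 0 = ![1, 1, 1] := rfl
  have p1 : basePentagon 1 = ![0, φ, φ - 1] := rfl
  have p2 : basePentagon 2 = ![-1, 1, 1] := rfl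
  have p3 : basePentagon 3 = ![1 - φ, 0, φ] := rfl
  have p4 : basePentagon 4 = ![φ - 1, 0, φ] := rfl
  have n0 : baseNeighbour 0 = ![1, φ, 0] := rfl
  have n1 : baseNeighbour 1 = ![-1, φ, 0] := rfl
  have n2 : baseNeighbour 2 = ![-φ, 0, 1] := rfl
  have n3 : baseNeighbour 3 = ![0, -1, φ] := rfl
  have n4 : baseNeighbour 4 = ![φ, 0, 1] := rfl
  revert i j
  apply forall_zmod_five <;> apply forall_zmod_five <;>
    simp only [p0, p1, p2, p3, p4, n0, n1, n2, n3, n4, dotProduct_fin_three, Matrix.cons_val]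
  all_goals first
    | exact iff_of_true (by linarith) (by decide)
    | exact iff_of_false (ne_of_lt (by linarith)) (by decide)

theorem mem_range_basePentagon {v : Fin 3 → ℝ} (hv : v ∈ euclVertices)
    (h : baseNormal ⬝ᵥ v = φ ^ 2) : v ∈ Set.range basePentagon := by
  have hφ := goldenRatio_sq
  have hφ' := goldenRatio_gt
  have eq_vec (a b c : ℝ) (h0 : v 0 = a) (h1 : v 1 = b) (h2 : v 2 = c) : ![a, b, c] = v := by
    subst h0 h1 h2
    ext j
    fin_cases j <;> rfl
  rw [dotProduct_baseNormal] at h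
  rcases (mem_euclVertices_iff v).1 hv with
    ⟨h0, h1, h2⟩ | ⟨h0, h1, h2⟩ | ⟨h1, h2, h0⟩ | ⟨h2, h0, h1⟩
  · have h1' : v 1 = 1 := (eq_or_eq_neg_of_abs h1).resolve_right fun h' => by
      rcases eq_or_eq_neg_of_abs h2 with h2 | h2 <;> rw [h', h2] at h <;> linarith
    have h2' : v 2 = 1 := (eq_or_eq_neg_of_abs h2).resolve_right fun h' => by
      rw [h1', h'] at h; linarith
    rcases eq_or_eq_neg_of_abs h0 with h0 | h0
    · exact ⟨0, eq_vec _ _ _ h0 h1' h2'⟩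
    · exact ⟨2, eq_vec _ _ _ h0 h1' h2'⟩
  · have h1' : v 1 = φ := (eq_or_eq_neg_of_abs h1).resolve_right fun h' => by
      rcases eq_or_eq_neg_of_abs h2 with h2 | h2 <;> rw [h', h2] at h <;> linarith
    have h2' : v 2 = φ - 1 := (eq_or_eq_neg_of_abs h2).resolve_right fun h' => by
      rw [h1', h'] at h; linarith
    exact ⟨1, eq_vec _ _ _ h0 h1' h2'⟩
  · have h2' : v 2 = φ := (eq_or_eq_neg_of_abs h2).resolve_right fun h' => by
      rw [h1, h'] at h; linarith
    rcases eq_or_eq_neg_of_abs h0 with h0 | h0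
    · exact ⟨4, eq_vec _ _ _ h0 h1 h2'⟩
    · exact ⟨3, eq_vec _ _ _ (by linarith) h1 h2'⟩
  · rcases eq_or_eq_neg_of_abs h1 with h1 | h1 <;> rw [h1, h2] at h <;> linarith

theorem baseNormal_dotProduct_basePentagon (i : ZMod 5) :
    baseNormal ⬝ᵥ basePentagon i = φ ^ 2 := by
  have hφ := goldenRatio_sq
  rw [dotProduct_baseNormal]
  revert i
  apply forall_zmod_five
  · change 1 + φ * 1 = φ ^ 2; linarith
  · change φ + φ * (φ - 1) = φ ^ 2; ring
  · change 1 + φ * 1 = φ ^ 2; linarith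
  · change 0 + φ * φ = φ ^ 2; ring
  · change 0 + φ * φ = φ ^ 2; ring

/-- `p` lists the vertices of the face with normal `n` in cyclic order, and `m i` is the normal of
the face on the other side of the edge from `p i` to `p (i + 1)`. -/
structure IsPentagon (n : Fin 3 → ℝ) (p m : ZMod 5 → Fin 3 → ℝ) : Prop where
  mem_vertices : ∀ i, p i ∈ euclVertices
  mem_normals : ∀ i, m i ∈ euclNormals
  dotProduct_eq : ∀ i, n ⬝ᵥ p i = φ ^ 2
  mem_range : ∀ v ∈ euclVertices, n ⬝ᵥ v = φ ^ 2 → v ∈ Set.range p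
  neighbour_iff : ∀ i j, m i ⬝ᵥ p j = φ ^ 2 ↔ j = i ∨ j = i + 1
  dotProduct_succ : ∀ i, p i ⬝ᵥ p (i + 1) = 2 * φ - 1
  dotProduct_pred_succ : ∀ i, p (i - 1) ⬝ᵥ p (i + 1) = 1

theorem exists_isPentagon {n : Fin 3 → ℝ} (hn : n ∈ euclNormals) : ∃ p m, IsPentagon n p m := by
  obtain ⟨ε, i, hε, rfl⟩ := exists_signedShift_baseNormal hn
  refine ⟨fun j => signedShift ε i (basePentagon j), fun j => signedShift ε i (baseNeighbour j),
    fun j => signedShift_mem_euclVertices hε i (basePentagon_mem j),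
    fun j => signedShift_mem_euclNormals hε i (baseNeighbour_mem j), fun j => ?_,
    fun v hv h => ?_, fun j k => ?_, fun j => ?_, fun j => ?_⟩
  · rw [dotProduct_signedShift hε, baseNormal_dotProduct_basePentagon]
  · rw [dotProduct_signedShift_left hε] at h
    obtain ⟨j, hj⟩ := mem_range_basePentagon
      (signedShift_mem_euclVertices (fun j => hε (j + i)) (-i) hv) h
    exact ⟨j, by simp only [hj, signedShift_signedShift_inverse hε]⟩
  · rw [dotProduct_signedShift hε, baseNeighbour_dotProduct_eq_iff]
  · rw [dotProduct_signedShift hε, basePentagon_dotProduct_succ]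
  · rw [dotProduct_signedShift hε, basePentagon_dotProduct_pred_succ]

theorem IsPentagon.injective {n : Fin 3 → ℝ} {p m : ZMod 5 → Fin 3 → ℝ} (h : IsPentagon n p m) :
    Function.Injective p := by
  -- A vertex of a 5-cycle is determined by the sides that contain it.
  have key : ∀ j k : ZMod 5, (∀ i, (j = i ∨ j = i + 1) ↔ (k = i ∨ k = i + 1)) → j = k := by
    decide
  intro j k hjk
  exact key j k fun i => by rw [← h.neighbour_iff, ← h.neighbour_iff, hjk]

/-! ### The dodecahedron as a convex hull -/

theorem one_zero_mem_of_vertices_mem {K : PointedCone ℝ (ℝ × (Fin 3 → ℝ))}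
    (hK : ∀ v ∈ euclVertices, ((1 : ℝ), v) ∈ K) : ((1 : ℝ), (0 : Fin 3 → ℝ)) ∈ K := by
  have h0 := basePentagon_mem 0
  have h := K.smul_mem (r := 1 / 2) (by norm_num)
    (K.add_mem (hK _ h0) (hK _ (neg_mem_euclVertices h0)))
  convert h using 1
  ext <;> norm_num

theorem one_midpoint_mem_of_vertices_mem {K : PointedCone ℝ (ℝ × (Fin 3 → ℝ))}
    (hK : ∀ v ∈ euclVertices, ((1 : ℝ), v) ∈ K) :
    ((1 : ℝ), (![0, 0, φ] : Fin 3 → ℝ)) ∈ K := by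
  have h := K.smul_mem (r := 1 / 2) (by norm_num)
    (K.add_mem (hK _ (basePentagon_mem 3)) (hK _ (basePentagon_mem 4)))
  have p3 : basePentagon 3 = ![1 - φ, 0, φ] := rfl
  have p4 : basePentagon 4 = ![φ - 1, 0, φ] := rfl
  rw [p3, p4] at h
  convert h using 1
  refine Prod.ext (by norm_num) ?_
  ext j
  fin_cases j <;> simp
  ring

/-- The part of the cone over the dodecahedron between the positive octant and the cone over
the face with normal `(0, 1, φ)`. -/
theorem mem_cone_of_octant {K : PointedCone ℝ (ℝ × (Fin 3 → ℝ))}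
    (hK : ∀ v ∈ euclVertices, ((1 : ℝ), v) ∈ K) {h : ℝ} {z : Fin 3 → ℝ} (hz : ∀ j, 0 ≤ z j)
    (hh : z 1 + φ * z 2 ≤ φ ^ 2 * h) (h1 : z 2 + φ * z 0 ≤ z 1 + φ * z 2)
    (h2 : z 0 + φ * z 1 ≤ z 1 + φ * z 2) : (h, z) ∈ K := by
  have hφ := goldenRatio_sq
  have hφ' := goldenRatio_gt
  have k0 := one_zero_mem_of_vertices_mem hK
  have k1 := one_midpoint_mem_of_vertices_mem hK
  have k2 : ((1 : ℝ), (![1, 1, 1] : Fin 3 → ℝ)) ∈ K := hK _ (basePentagon_mem 0)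
  have k3 : ((1 : ℝ), (![0, φ, φ - 1] : Fin 3 → ℝ)) ∈ K := hK _ (basePentagon_mem 1)
  have k4 : ((1 : ℝ), (![φ - 1, 0, φ] : Fin 3 → ℝ)) ∈ K := hK _ (basePentagon_mem 4)
  -- Since `2 - φ = φ⁻²`, this slack in the face inequality is the coefficient of the centre `(1,
  -- 0)`.
  have hh' : 0 ≤ h - (2 - φ) * (z 1 + φ * z 2) := by
    nlinarith [mul_le_mul_of_nonneg_left hh (sub_nonneg.2 goldenRatio_lt_two.le),
      show (2 - φ) * (φ ^ 2 * h) = h by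
        linear_combination (1 - φ) * h * hφ]
  have := hz 0
  have := hz 1
  -- The part of the face in the octant is a quadrilateral with corners `k1`, `k4`, `k2`, `k3`. The
  -- plane `z 0 = z 1` contains the diagonal from `k1` to `k2` and cuts it into two triangles. In
  -- each, the coefficient `hα` of `k1` is nonnegative by `h1`, respectively `h2`.
  rcases le_total (z 1) (z 0) with hle | hle
  · have hα : 0 ≤ (φ - 1) * (z 2 - z 1) - φ * (z 0 - z 1) := by nlinarith
    have hm := K.add_mem (K.add_mem (K.add_mem
      (K.smul_mem hα k1)
      (K.smul_mem (mul_nonneg goldenRatio_pos.le (sub_nonneg.2 hle)) k4))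
      (K.smul_mem (hz 1) k2)) (K.smul_mem hh' k0)
    convert hm using 1
    refine Prod.ext ?_ ?_
    · simp only [Prod.fst_add, Prod.smul_fst, smul_eq_mul]
      linear_combination (-z 2) * hφ
    · ext j
      fin_cases j <;> simp
      · linear_combination (z 1 - z 0) * hφ
      · linear_combination (z 1 - z 2) * hφ
  · have hα : 0 ≤ (φ - 1) * (z 2 - z 0 - (2 - φ) * (z 1 - z 0)) := by
      refine mul_nonneg (by linarith) ?_
      nlinarith
    have hm := K.add_mem (K.add_mem (K.add_mem
      (K.smul_mem hα k1)
      (K.smul_mem (mul_nonneg (sub_pos.2 one_lt_goldenRatio).le (sub_nonneg.2 hle)) k3))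
      (K.smul_mem (hz 0) k2)) (K.smul_mem hh' k0)
    convert hm using 1
    refine Prod.ext ?_ ?_
    · simp only [Prod.fst_add, Prod.smul_fst, smul_eq_mul]
      linear_combination (z 0 - z 1 - z 2) * hφ
    · ext j
      fin_cases j <;> simp
      · linear_combination (z 0 - z 1) * hφ
      · linear_combination (z 0 - z 2 + (1 - φ) * (z 1 - z 0)) * hφ

theorem mem_cone_of_forall_dotProduct_le {K : PointedCone ℝ (ℝ × (Fin 3 → ℝ))}
    (hK : ∀ v ∈ euclVertices, ((1 : ℝ), v) ∈ K) {h : ℝ} {y : Fin 3 → ℝ}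
    (hy : ∀ n ∈ euclNormals, n ⬝ᵥ y ≤ φ ^ 2 * h) : (h, y) ∈ K := by
  choose s hs hs' using exists_abs_eq_one_mul_abs
  -- Absolute values move `y` into the positive octant, and maximality of `i` says that, after a
  -- cyclic shift, the ray through it meets the face with normal `(0, 1, φ)`. Since `K` is
  -- arbitrary, it can be replaced by its preimage under the symmetry.
  obtain ⟨i, hi⟩ := Finite.exists_max fun i : Fin 3 => |y (i + 1)| + φ * |y (i + 2)|
  set ε : Fin 3 → ℝ := fun j => s (y j)
  have hε : ∀ j, |ε j| = 1 := fun j => hs _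
  set z : Fin 3 → ℝ := fun j => |y (j + i)|
  have hyz : y = signedShift ε i z := by
    ext j
    rw [signedShift_apply]
    change y j = s (y j) * |y (j - i + i)|
    rw [sub_add_cancel, ← hs']
  have hz1 : z 1 = |y (i + 1)| := by simp only [z, add_comm]
  have hz2 : z 2 = |y (i + 2)| := by simp only [z, add_comm]
  have e1 : ∀ i : Fin 3, i + 1 + 1 = i + 2 ∧ i + 1 + 2 = 0 + i ∧ i + 2 + 1 = 0 + i ∧
    i + 2 + 2 = i + 1 := by decide
  have i1 := hi (i + 1)
  have i2 := hi (i + 2)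
  simp only [e1] at i1 i2
  have hm := mem_cone_of_octant (K := K.comap (LinearMap.prodMap LinearMap.id (signedShift ε i)))
    (h := h) (z := z)
    (fun v hv => hK _ (signedShift_mem_euclVertices hε i hv)) (fun j => abs_nonneg _) (by
      have := hy _ (signedShift_mem_euclNormals hε i baseNormal_mem)
      rwa [hyz, dotProduct_signedShift hε, dotProduct_baseNormal] at this)
    (by rw [hz1, hz2]; exact i1) (by rw [hz1, hz2]; exact i2)
  rw [hyz]
  exact hm

theorem dotProduct_self_nonneg (y : Fin 3 → ℝ) : 0 ≤ y ⬝ᵥ y := by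
  rw [dotProduct_fin_three]
  nlinarith [sq_nonneg (y 0), sq_nonneg (y 1), sq_nonneg (y 2)]

theorem dotProduct_sq_le (x y : Fin 3 → ℝ) : (x ⬝ᵥ y) ^ 2 ≤ (x ⬝ᵥ x) * (y ⬝ᵥ y) := by
  simp only [dotProduct_fin_three]
  nlinarith [sq_nonneg (x 0 * y 1 - x 1 * y 0), sq_nonneg (x 0 * y 2 - x 2 * y 0),
    sq_nonneg (x 1 * y 2 - x 2 * y 1)]

theorem nonneg_of_forall_dotProduct_le {h : ℝ} {y : Fin 3 → ℝ}
    (hy : ∀ n ∈ euclNormals, n ⬝ᵥ y ≤ φ ^ 2 * h) : 0 ≤ h := by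
  have h1 := hy _ baseNormal_mem
  have h2 := hy _ (neg_mem_euclNormals baseNormal_mem)
  rw [neg_dotProduct] at h2
  have : 0 < φ ^ 2 := pow_pos goldenRatio_pos 2
  nlinarith

/-- The dodecahedron lies in the ball of radius `√3`. -/
theorem dotProduct_self_le {h : ℝ} {y : Fin 3 → ℝ}
    (hy : ∀ n ∈ euclNormals, n ⬝ᵥ y ≤ φ ^ 2 * h) : y ⬝ᵥ y ≤ 3 * h ^ 2 := by
  have hh := nonneg_of_forall_dotProduct_le hy
  have hy0 := dotProduct_self_nonneg y
  -- This half-space depends on `y` itself and contains the vertices by Cauchy–Schwarz. Membership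
  -- of `(h, y)` then reads `|y|² ≤ √3 |y| h`.
  let K : PointedCone ℝ (ℝ × (Fin 3 → ℝ)) :=
    { carrier := {q | y ⬝ᵥ q.2 ≤ √(3 * (y ⬝ᵥ y)) * q.1}
      add_mem' := fun {a b} ha hb => by
        change y ⬝ᵥ (a.2 + b.2) ≤ _ * (a.1 + b.1)
        rw [dotProduct_add, mul_add]
        exact add_le_add ha hb
      zero_mem' := by
        change y ⬝ᵥ 0 ≤ _ * 0
        simp
      smul_mem' := fun c a ha => by
        change y ⬝ᵥ ((c : ℝ) • a.2) ≤ _ * ((c : ℝ) * a.1)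
        rw [dotProduct_smul, smul_eq_mul, mul_left_comm]
        exact mul_le_mul_of_nonneg_left ha c.2 }
  have hK : ∀ v ∈ euclVertices, ((1 : ℝ), v) ∈ K := fun v hv => by
    change y ⬝ᵥ v ≤ _ * 1
    rw [mul_one]
    apply Real.le_sqrt_of_sq_le
    rw [mul_comm 3, ← dotProduct_self_of_mem_euclVertices hv]
    exact dotProduct_sq_le y v
  have hm : y ⬝ᵥ y ≤ √(3 * (y ⬝ᵥ y)) * h := mem_cone_of_forall_dotProduct_le hK hy
  have hs := Real.mul_self_sqrt (show 0 ≤ 3 * (y ⬝ᵥ y) by linarith)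
  have hs0 := Real.sqrt_nonneg (3 * (y ⬝ᵥ y))
  rcases hs0.eq_or_lt with h0 | h0
  · rw [← h0] at hm; nlinarith
  · have : √(3 * (y ⬝ᵥ y)) ≤ 3 * h := by nlinarith
    nlinarith

/-! ### The Lorentzian form -/

theorem form_comm (x y : Fin 4 → ℝ) : form x y = form y x := by
  simp only [form]; ring

theorem form_add_right (x y z : Fin 4 → ℝ) : form x (y + z) = form x y + form x z := by
  simp only [form, Pi.add_apply]; ring

theorem form_smul_right (c : ℝ) (x y : Fin 4 → ℝ) : form x (c • y) = c * form x y := by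
  simp only [form, Pi.smul_apply, smul_eq_mul]; ring

theorem form_add_left (x y z : Fin 4 → ℝ) : form (x + y) z = form x z + form y z := by
  simp only [form, Pi.add_apply]; ring

theorem form_smul_left (c : ℝ) (x y : Fin 4 → ℝ) : form (c • x) y = c * form x y := by
  simp only [form, Pi.smul_apply, smul_eq_mul]; ring

/-- Lorentzian product with `n` as a linear functional. -/
def formL (n : Fin 4 → ℝ) : (Fin 4 → ℝ) →ₗ[ℝ] ℝ where
  toFun := form n
  map_add' := form_add_right n
  map_smul' c := form_smul_right c n

theorem formL_apply (n x : Fin 4 → ℝ) : formL n x = form n x := rfl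

theorem continuous_form_right (n : Fin 4 → ℝ) : Continuous (form n) := by
  unfold form; fun_prop

theorem finrank_ker_formL {n : Fin 4 → ℝ} (hn : 0 < form n n) :
    Module.finrank ℝ (LinearMap.ker (formL n)) = 3 := by
  have h : formL n ≠ 0 := fun h => hn.ne' (by rw [← formL_apply, h, LinearMap.zero_apply])
  have := Module.Dual.finrank_ker_add_one_of_ne_zero h
  simpa using this

theorem H3.ne_zero (x : H3) : x.1 ≠ 0 := fun h => by
  have := x.2.2
  rw [h] at this
  exact lt_irrefl _ this

theorem form_neg (x y : H3) : form x.1 y.1 < 0 := by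
  obtain ⟨x, hx, hx0⟩ := x
  obtain ⟨y, hy, hy0⟩ := y
  simp only [form] at hx hy ⊢
  have h : x 1 * y 1 + x 2 * y 2 + x 3 * y 3 < x 0 * y 0 := by
    apply lt_of_pow_lt_pow_left₀ 2 (by positivity)
    have h1 : (x 0 * y 0) ^ 2 =
        (1 + x 1 ^ 2 + x 2 ^ 2 + x 3 ^ 2) * (1 + y 1 ^ 2 + y 2 ^ 2 + y 3 ^ 2) := by
      rw [mul_pow, show x 0 ^ 2 = 1 + x 1 ^ 2 + x 2 ^ 2 + x 3 ^ 2 by linarith,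
        show y 0 ^ 2 = 1 + y 1 ^ 2 + y 2 ^ 2 + y 3 ^ 2 by linarith]
    rw [h1]
    nlinarith [sq_nonneg (x 1 * y 2 - x 2 * y 1), sq_nonneg (x 1 * y 3 - x 3 * y 1),
      sq_nonneg (x 2 * y 3 - x 3 * y 2), sq_nonneg (x 1), sq_nonneg (x 2), sq_nonneg (x 3),
      sq_nonneg (y 1), sq_nonneg (y 2), sq_nonneg (y 3)]
  linarith

theorem exists_H3_eq_smul {z : Fin 4 → ℝ} (hz : form z z < 0) (h0 : 0 < z 0) :
    ∃ x : H3, ∃ c : ℝ, 0 < c ∧ x.1 = c • z := by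
  have hs : 0 < √(-form z z) := Real.sqrt_pos.2 (by linarith)
  have hss := Real.mul_self_sqrt (show 0 ≤ -form z z by linarith)
  refine ⟨⟨(√(-form z z))⁻¹ • z, ?_, ?_⟩, _, inv_pos.2 hs, rfl⟩
  · rw [form_smul_left, form_smul_right, ← mul_assoc, ← mul_inv, hss, inv_neg, neg_mul,
      inv_mul_cancel₀ hz.ne]
  · rw [Pi.smul_apply, smul_eq_mul]; positivity

theorem H3.eq_of_eq_smul {x y : H3} {c : ℝ} (hc : 0 ≤ c) (h : x.1 = c • y.1) : x = y := by
  have h1 := x.2.1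
  rw [h, form_smul_left, form_smul_right, y.2.1] at h1
  have : c = 1 := by nlinarith
  exact Subtype.ext (by rw [h, this, one_smul])

theorem isConvex_halfSpace (n : Fin 4 → ℝ) : IsConvex (halfSpace n) := by
  rintro x hx y hy z ⟨a, b, ha, hb, hz⟩
  change form n z.1 ≤ 0
  rw [hz, form_add_right, form_smul_right, form_smul_right]
  have hx : form n x.1 ≤ 0 := hx
  have hy : form n y.1 ≤ 0 := hy
  nlinarith

theorem isConvex_plane (n : Fin 4 → ℝ) : IsConvex (plane n) := by
  rintro x hx y hy z ⟨a, b, ha, hb, hz⟩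
  change form n z.1 = 0
  have hx : form n x.1 = 0 := hx
  have hy : form n y.1 = 0 := hy
  rw [hz, form_add_right, form_smul_right, form_smul_right, hx, hy]
  ring

theorem IsConvex.inter {S T : Set H3} (hS : IsConvex S) (hT : IsConvex T) : IsConvex (S ∩ T) :=
  fun x hx y hy => Set.subset_inter (hS x hx.1 y hy.1) (hT x hx.2 y hy.2)

/-- The cone over a geodesically convex set. -/
def coneOver {T : Set H3} (hT : IsConvex T) : PointedCone ℝ (Fin 4 → ℝ) where
  carrier := {z | z = 0 ∨ ∃ x ∈ T, ∃ c : ℝ, 0 < c ∧ z = c • x.1}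
  zero_mem' := Or.inl rfl
  add_mem' := by
    rintro _ _ (rfl | ⟨x, hx, c, hc, rfl⟩) (rfl | ⟨y, hy, d, hd, rfl⟩)
    · left; simp
    · right; exact ⟨y, hy, d, hd, by simp⟩
    · right; exact ⟨x, hx, c, hc, by simp⟩
    · right
      -- The sum of two future timelike vectors is future timelike, so it can be rescaled to the
      -- hyperboloid, where it lies on the segment from `x` to `y`.
      have h1 : form (c • x.1 + d • y.1) (c • x.1 + d • y.1) < 0 := by
        simp only [form_add_left, form_add_right, form_smul_left, form_smul_right, x.2.1, y.2.1,
          form_comm y.1 x.1]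
        nlinarith [mul_pos hc hd, form_neg x y, mul_pos hc hc, mul_pos hd hd,
          mul_neg_of_pos_of_neg (mul_pos hc hd) (form_neg x y)]
      have h2 : 0 < (c • x.1 + d • y.1) 0 := by
        have := x.2.2
        have := y.2.2
        simp only [Pi.add_apply, Pi.smul_apply, smul_eq_mul]
        positivity
      obtain ⟨w, e, he, hw⟩ := exists_H3_eq_smul h1 h2
      refine ⟨w, hT x hx y hy ⟨e * c, e * d, by positivity, by positivity, ?_⟩, e⁻¹,
        inv_pos.2 he, ?_⟩
      · rw [hw, smul_add, smul_smul, smul_smul]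
      · rw [hw, smul_smul, inv_mul_cancel₀ he.ne', one_smul]
  smul_mem' := by
    rintro ⟨c, hc⟩ _ (rfl | ⟨x, hx, d, hd, rfl⟩)
    · left; simp
    · change c • d • x.1 = 0 ∨ ∃ y ∈ T, ∃ e : ℝ, 0 < e ∧ c • d • x.1 = e • y.1
      rcases hc.eq_or_lt with rfl | hc
      · left; simp
      · right; exact ⟨x, hx, c * d, mul_pos hc hd, by rw [smul_smul]⟩

theorem mem_coneOver {T : Set H3} (hT : IsConvex T) (x : H3) : x.1 ∈ coneOver hT ↔ x ∈ T := by
  constructor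
  · rintro (h | ⟨y, hy, c, hc, h⟩)
    · exact absurd h x.ne_zero
    · rwa [H3.eq_of_eq_smul hc.le h]
  · exact fun hx => Or.inr ⟨x, hx, 1, one_pos, (one_smul _ _).symm⟩

theorem mem_hull_of_mem_pointedConeHull {S : Set H3} {x : H3}
    (hx : x.1 ∈ PointedCone.hull ℝ ((fun y : H3 => y.1) '' S)) : x ∈ hull S := by
  rintro T ⟨hT, hST⟩
  refine (mem_coneOver hT x).1 ((Submodule.span_le.2 ?_) hx)
  rintro _ ⟨y, hy, rfl⟩
  exact (mem_coneOver hT y).2 (hST hy)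

/-- A conic combination on the boundary of a half-space containing the generators only involves
generators on that boundary. -/
theorem mem_pointedConeHull_of_form_eq_zero {S : Set (Fin 4 → ℝ)} {m z : Fin 4 → ℝ}
    (hS : ∀ w ∈ S, form m w ≤ 0) (hz : z ∈ PointedCone.hull ℝ S) (h0 : form m z = 0) :
    z ∈ PointedCone.hull ℝ {w ∈ S | form m w = 0} := by
  suffices h : form m z ≤ 0 ∧
      (form m z = 0 → z ∈ PointedCone.hull ℝ {w ∈ S | form m w = 0}) from h.2 h0
  clear h0
  induction hz using Submodule.span_induction with
  | mem w hw => exact ⟨hS w hw, fun h => PointedCone.subset_hull ⟨hw, h⟩⟩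
  | zero => exact ⟨((formL m).map_zero).le, fun _ => Submodule.zero_mem _⟩
  | add a b _ _ ha hb =>
    rw [form_add_right]
    exact ⟨add_nonpos ha.1 hb.1, fun h => Submodule.add_mem _ (ha.2 (by linarith [ha.1, hb.1]))
      (hb.2 (by linarith [ha.1, hb.1]))⟩
  | smul c a _ ha =>
    have e : form m (c • a) = (c : ℝ) * form m a := form_smul_right c m a
    have hc : (0 : ℝ) ≤ c := c.2
    rw [e]
    refine ⟨mul_nonpos_of_nonneg_of_nonpos hc ha.1, fun h => ?_⟩
    rcases mul_eq_zero.1 h with h | h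
    · have : c = 0 := Subtype.ext h
      rw [this, zero_smul]
      exact Submodule.zero_mem _
    · exact Submodule.smul_mem _ _ (ha.2 h)

/-! ### The hyperbolic dodecahedron -/

/-- The outer normal of the hyperbolic face corresponding to the Euclidean normal `n`. -/
def normalVec (n : Fin 3 → ℝ) : Fin 4 → ℝ := ![√φ, n 0, n 1, n 2]

/-- The linear map which sends the cone over the Euclidean dodecahedron to the cone over the
hyperbolic one, and maps `(1, v)` to the hyperboloid for Euclidean vertices `v`. -/
def coneMap : (ℝ × (Fin 3 → ℝ)) →ₗ[ℝ] (Fin 4 → ℝ) where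
  toFun q := √(φ / 2) • ![√φ * φ * q.1, q.2 0, q.2 1, q.2 2]
  map_add' p q := by
    ext j
    fin_cases j <;> simp <;> ring
  map_smul' c q := by
    ext j
    fin_cases j <;> simp <;> ring

theorem coneMap_apply (h : ℝ) (y : Fin 3 → ℝ) :
    coneMap (h, y) = √(φ / 2) • ![√φ * φ * h, y 0, y 1, y 2] := rfl

theorem sqrt_goldenRatio_mul_self : √φ * √φ = φ := Real.mul_self_sqrt goldenRatio_pos.le

theorem sqrt_half_goldenRatio_mul_self : √(φ / 2) * √(φ / 2) = φ / 2 :=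
  Real.mul_self_sqrt (div_pos goldenRatio_pos two_pos).le

theorem sqrt_half_goldenRatio_pos : 0 < √(φ / 2) :=
  Real.sqrt_pos.2 (div_pos goldenRatio_pos two_pos)

theorem sqrt_goldenRatio_pos : 0 < √φ := Real.sqrt_pos.2 goldenRatio_pos

theorem coneMap_surjective : Function.Surjective coneMap := by
  intro x
  have h1 := sqrt_half_goldenRatio_pos.ne'
  have h2 := sqrt_goldenRatio_pos.ne'
  have h3 := goldenRatio_ne_zero
  refine ⟨(x 0 / (√(φ / 2) * (√φ * φ)), fun j => x j.succ / √(φ / 2)), ?_⟩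
  rw [coneMap_apply]
  generalize φ = f at *
  ext j
  fin_cases j
  · simp
    field_simp
  · change √(f / 2) * (x 1 / √(f / 2)) = x 1
    field_simp
  · change √(f / 2) * (x 2 / √(f / 2)) = x 2
    field_simp
  · change √(f / 2) * (x 3 / √(f / 2)) = x 3
    field_simp

theorem form_vec (a b : ℝ) (x y : Fin 3 → ℝ) :
    form ![a, x 0, x 1, x 2] ![b, y 0, y 1, y 2] = x ⬝ᵥ y - a * b := by
  rw [dotProduct_fin_three]
  change -(a * b) + x 0 * y 0 + x 1 * y 1 + x 2 * y 2 = _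
  ring

theorem form_normalVec_coneMap (n : Fin 3 → ℝ) (h : ℝ) (y : Fin 3 → ℝ) :
    form (normalVec n) (coneMap (h, y)) = √(φ / 2) * (n ⬝ᵥ y - φ ^ 2 * h) := by
  rw [coneMap_apply, form_smul_right, normalVec, form_vec]
  linear_combination (-√(φ / 2) * φ * h) * sqrt_goldenRatio_mul_self

theorem form_normalVec_normalVec (n m : Fin 3 → ℝ) :
    form (normalVec n) (normalVec m) = n ⬝ᵥ m - φ := by
  rw [normalVec, normalVec, form_vec, sqrt_goldenRatio_mul_self]

/-- Here `2 * φ + 1 = φ ^ 3`. The factor `φ / 2` normalises the vertices, as `φ / 2 * (3 - φ ^ 3) =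
-1`. -/
theorem form_coneMap_coneMap (h k : ℝ) (x y : Fin 3 → ℝ) :
    form (coneMap (h, x)) (coneMap (k, y)) = φ / 2 * (x ⬝ᵥ y - (2 * φ + 1) * (h * k)) := by
  rw [coneMap_apply, coneMap_apply, form_smul_left, form_smul_right, form_vec, ← mul_assoc,
    sqrt_half_goldenRatio_mul_self]
  linear_combination (-φ / 2 * φ * h * φ * k) * sqrt_goldenRatio_mul_self
    + (-φ / 2 * (φ + 1) * h * k) * goldenRatio_sq

theorem form_normalVec_self_pos {n : Fin 3 → ℝ} (hn : n ∈ euclNormals) :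
    0 < form (normalVec n) (normalVec n) := by
  rw [form_normalVec_normalVec, dotProduct_self_of_mem_euclNormals hn]; linarith

theorem form_normalVec_coneMap_nonpos_iff (n : Fin 3 → ℝ) (h : ℝ) (y : Fin 3 → ℝ) :
    form (normalVec n) (coneMap (h, y)) ≤ 0 ↔ n ⬝ᵥ y ≤ φ ^ 2 * h := by
  rw [form_normalVec_coneMap, ← sub_nonpos (a := n ⬝ᵥ y)]
  exact ⟨fun h => by_contra fun h' => h.not_gt
    (mul_pos sqrt_half_goldenRatio_pos (not_le.1 h')),
    mul_nonpos_of_nonneg_of_nonpos sqrt_half_goldenRatio_pos.le⟩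

theorem form_normalVec_coneMap_eq_zero_iff (n : Fin 3 → ℝ) (y : Fin 3 → ℝ) :
    form (normalVec n) (coneMap (1, y)) = 0 ↔ n ⬝ᵥ y = φ ^ 2 := by
  rw [form_normalVec_coneMap, mul_eq_zero, or_iff_right sqrt_half_goldenRatio_pos.ne', mul_one,
    sub_eq_zero]

/-- The hyperbolic vertex corresponding to the Euclidean vertex `v`. -/
def vertex (v : euclVertices) : H3 :=
  ⟨coneMap (1, v.1), by
    rw [form_coneMap_coneMap, dotProduct_self_of_mem_euclVertices v.2]
    linarith [goldenRatio_sq], by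
    rw [coneMap_apply]
    have h1 := sqrt_half_goldenRatio_pos
    have h2 := sqrt_goldenRatio_pos
    have h3 := goldenRatio_pos
    change 0 < √(φ / 2) * (√φ * φ * 1)
    exact mul_pos h1 (mul_pos (mul_pos h2 h3) one_pos)⟩

theorem vertex_val (v : euclVertices) : (vertex v).1 = coneMap (1, v.1) := rfl

/-- The right-angled regular hyperbolic dodecahedron. -/
def dodecahedron : Set H3 := ⋂ n ∈ normalVec '' euclNormals, halfSpace n

theorem mem_dodecahedron {x : H3} :
    x ∈ dodecahedron ↔ ∀ n ∈ euclNormals, form (normalVec n) x.1 ≤ 0 := by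
  simp [dodecahedron, halfSpace]

theorem vertex_mem (v : euclVertices) : vertex v ∈ dodecahedron :=
  mem_dodecahedron.2 fun n hn => by
    rw [vertex_val, form_normalVec_coneMap_nonpos_iff, mul_one]
    exact dotProduct_le_of_mem hn v.2

theorem isConvex_dodecahedron : IsConvex dodecahedron := by
  intro x hx y hy z hz
  rw [mem_dodecahedron] at *
  exact fun n hn => isConvex_halfSpace (normalVec n) x (hx n hn) y (hy n hn) hz

theorem mem_pointedConeHull_vertices {z : Fin 4 → ℝ}
    (hz : ∀ n ∈ euclNormals, form (normalVec n) z ≤ 0) :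
    z ∈ PointedCone.hull ℝ ((fun x : H3 => x.1) '' Set.range vertex) := by
  obtain ⟨⟨h, y⟩, rfl⟩ := coneMap_surjective z
  refine mem_cone_of_forall_dotProduct_le (K := PointedCone.comap coneMap (PointedCone.hull ℝ
    ((fun x : H3 => x.1) '' Set.range vertex))) (fun v hv => ?_)
    fun n hn => (form_normalVec_coneMap_nonpos_iff n h y).1 (hz n hn)
  exact PointedCone.subset_hull ⟨vertex ⟨v, hv⟩, ⟨_, rfl⟩, rfl⟩

/-- The ball bound gives `-form z z ≥ h ^ 2`, while `z 0 ^ 2 = φ ^ 4 / 2 * h ^ 2` and `φ ^ 4 / 2 <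
4`. The estimate shows both that the cone is timelike and that its trace on the hyperboloid is
bounded. -/
theorem sq_le_of_forall_form_nonpos {z : Fin 4 → ℝ}
    (hz : ∀ n ∈ euclNormals, form (normalVec n) z ≤ 0) : 0 ≤ z 0 ∧ z 0 ^ 2 ≤ 4 * -form z z := by
  obtain ⟨⟨h, y⟩, rfl⟩ := coneMap_surjective z
  have hy := fun n hn => (form_normalVec_coneMap_nonpos_iff n h y).1 (hz n hn)
  have h0 := nonneg_of_forall_dotProduct_le hy
  have h1 := dotProduct_self_le hy
  have e : coneMap (h, y) 0 = √(φ / 2) * (√φ * φ * h) := rfl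
  have hφ := goldenRatio_sq
  have hφ' := goldenRatio_lt_two
  have hφ0 := goldenRatio_pos
  refine ⟨?_, ?_⟩
  · rw [e]
    exact mul_nonneg sqrt_half_goldenRatio_pos.le
      (mul_nonneg (mul_nonneg sqrt_goldenRatio_pos.le hφ0.le) h0)
  · have e2 : coneMap (h, y) 0 ^ 2 = (3 * φ + 2) / 2 * h ^ 2 := by
      rw [e, mul_pow, mul_pow, mul_pow, sq (√(φ / 2)), sq (√φ), sqrt_half_goldenRatio_mul_self,
        sqrt_goldenRatio_mul_self]
      linear_combination (φ ^ 2 + φ + 2) / 2 * h ^ 2 * hφ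
    rw [e2, form_coneMap_coneMap]
    have h2 : h ^ 2 ≤ -(φ / 2 * (y ⬝ᵥ y - (2 * φ + 1) * (h * h))) := by
      nlinarith [mul_nonneg hφ0.le (sub_nonneg.2 h1)]
    nlinarith [sq_nonneg h]

theorem timelike_of_forall_form_nonpos {z : Fin 4 → ℝ}
    (hz : ∀ n ∈ euclNormals, form (normalVec n) z ≤ 0) (hz0 : z ≠ 0) :
    form z z < 0 ∧ 0 < z 0 := by
  obtain ⟨h0, h1⟩ := sq_le_of_forall_form_nonpos hz
  have hpos : 0 < z 0 := by
    refine h0.lt_of_ne' fun h => hz0 ?_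
    rw [h] at h1
    simp only [form, h] at h1
    ext j
    fin_cases j
    · exact h
    all_goals simp only [Fin.mk_one, Fin.reduceFinMk, Pi.zero_apply]
    all_goals nlinarith [sq_nonneg (z 1), sq_nonneg (z 2), sq_nonneg (z 3)]
  exact ⟨by nlinarith, hpos⟩

theorem isCompact_dodecahedron : IsCompact dodecahedron := by
  rw [Subtype.isCompact_iff]
  -- The open condition `0 < z 0` is implied by the others, so the image in `ℝ⁴` is closed.
  have himg : (Subtype.val '' dodecahedron : Set (Fin 4 → ℝ)) =
      {z | form z z = -1} ∩ ⋂ n ∈ euclNormals, {z | form (normalVec n) z ≤ 0} := by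
    ext z
    simp only [Set.mem_image, Set.mem_inter_iff, Set.mem_ofPred_eq, Set.mem_iInter]
    constructor
    · rintro ⟨x, hx, rfl⟩
      exact ⟨x.2.1, mem_dodecahedron.1 hx⟩
    · rintro ⟨h1, h2⟩
      have hz0 : z ≠ 0 := by
        rintro rfl
        simp [form] at h1
      exact ⟨⟨z, h1, (timelike_of_forall_form_nonpos h2 hz0).2⟩, mem_dodecahedron.2 h2, rfl⟩
  have hclosed : IsClosed (Subtype.val '' dodecahedron : Set (Fin 4 → ℝ)) := by
    rw [himg]
    refine IsClosed.inter (isClosed_eq (by unfold form; fun_prop) continuous_const)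
      (isClosed_biInter fun n _ => isClosed_le (continuous_form_right _) continuous_const)
  refine (isCompact_Icc (a := fun _ => (-2 : ℝ)) (b := fun _ => 2)).of_isClosed_subset hclosed ?_
  rintro _ ⟨x, hx, rfl⟩
  obtain ⟨h0, h1⟩ := sq_le_of_forall_form_nonpos (mem_dodecahedron.1 hx)
  have h2 := x.2.1
  rw [h2] at h1
  simp only [form] at h2
  have key : ∀ j, x.1 j ^ 2 ≤ 2 ^ 2 := by
    intro j
    fin_cases j <;> simp only [Fin.zero_eta, Fin.mk_one, Fin.reduceFinMk] <;>
      nlinarith [sq_nonneg (x.1 1), sq_nonneg (x.1 2), sq_nonneg (x.1 3)]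
  exact ⟨fun j => (abs_le_of_sq_le_sq' (key j) two_pos.le).1,
    fun j => (abs_le_of_sq_le_sq' (key j) two_pos.le).2⟩

theorem nonempty_interior_dodecahedron : (interior dodecahedron).Nonempty := by
  let o : H3 := ⟨![1, 0, 0, 0], by simp [form], by simp⟩
  refine ⟨o, interior_maximal (s := dodecahedron)
    (t := ⋂ n ∈ euclNormals, {x : H3 | form (normalVec n) x.1 < 0}) ?_ ?_ ?_⟩
  · exact fun x hx => mem_dodecahedron.2 fun n hn => le_of_lt (Set.mem_iInter₂.1 hx n hn)
  · exact finite_euclNormals.isOpen_biInter fun n _ =>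
      isOpen_lt ((continuous_form_right _).comp continuous_subtype_val) continuous_const
  · refine Set.mem_iInter₂.2 fun n _ => ?_
    change -(√φ * 1) + n 0 * 0 + n 1 * 0 + n 2 * 0 < 0
    linarith [sqrt_goldenRatio_pos]

theorem isConvexPolyhedron_dodecahedron : IsConvexPolyhedron dodecahedron where
  isConvex := isConvex_dodecahedron
  isCompact := isCompact_dodecahedron
  nonempty_interior := nonempty_interior_dodecahedron
  eq_inter := ⟨normalVec '' euclNormals, finite_euclNormals.image _, by
    rintro _ ⟨n, hn, rfl⟩
    exact form_normalVec_self_pos hn, rfl⟩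

/-! ### Vertices -/

theorem vertex_injective : Function.Injective vertex := by
  intro v w h
  have h1 := (vertex v).2.1
  have h2 : form (vertex v).1 (vertex w).1 = -1 := by rw [← h, h1]
  rw [vertex_val, vertex_val, form_coneMap_coneMap] at h2
  have h3 : (v.1 ⬝ᵥ w.1 - 3) * φ = 0 := by linear_combination 2 * h2 + 2 * goldenRatio_sq
  have h4 := (mul_eq_zero.1 h3).resolve_right goldenRatio_ne_zero
  exact Subtype.ext (eq_of_dotProduct_eq (dotProduct_self_of_mem_euclVertices v.2)
    (dotProduct_self_of_mem_euclVertices w.2) (by linarith))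

/-- The supporting plane is, in the Klein model, the tangent plane at the vertex to the
circumscribed sphere. The sphere bound and Cauchy–Schwarz give `v ⬝ᵥ y ≤ 3 * h`, with equality only
for `y = h • v`. -/
theorem isVertex_vertex (v : euclVertices) : IsVertex dodecahedron (vertex v) := by
  have hφ := goldenRatio_sq
  have hφ' := goldenRatio_gt
  have hv := dotProduct_self_of_mem_euclVertices v.2
  -- the outer normal is a multiple of `(3, φ ^ (3 / 2) • v)`
  set m : Fin 4 → ℝ := coneMap (3, (2 * φ + 1) • v.1) with hm
  have key (h : ℝ) (y : Fin 3 → ℝ) :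
      form m (coneMap (h, y)) = φ / 2 * (2 * φ + 1) * (v.1 ⬝ᵥ y - 3 * h) := by
    rw [hm, form_coneMap_coneMap, smul_dotProduct, smul_eq_mul]
    ring
  have hc : 0 < φ / 2 * (2 * φ + 1) := by nlinarith
  have hle {h : ℝ} {y : Fin 3 → ℝ} (hy : ∀ n ∈ euclNormals, n ⬝ᵥ y ≤ φ ^ 2 * h) :
      v.1 ⬝ᵥ y ≤ 3 * h := by
    apply le_of_sq_le_sq _ (by linarith [nonneg_of_forall_dotProduct_le hy])
    nlinarith [dotProduct_sq_le v.1 y, dotProduct_self_le hy]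
  refine ⟨⟨m, ?_, ?_, ?_⟩, ?_⟩
  · nth_rw 2 [hm]
    rw [key, dotProduct_smul, hv, smul_eq_mul]
    exact mul_pos hc (by linarith)
  · intro x hx
    change form m x.1 ≤ 0
    rw [mem_dodecahedron] at hx
    obtain ⟨⟨h, y⟩, e⟩ := coneMap_surjective x.1
    rw [← e] at hx ⊢
    have hy := fun n hn => (form_normalVec_coneMap_nonpos_iff n h y).1 (hx n hn)
    rw [key]
    exact mul_nonpos_of_nonneg_of_nonpos hc.le (by linarith [hle hy])
  · refine Set.Subset.antisymm (Set.singleton_subset_iff.2 ⟨vertex_mem v, ?_⟩) ?_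
    · change form m (vertex v).1 = 0
      rw [vertex_val, key, hv]; ring
    · rintro x ⟨hx, hx'⟩
      have hx' : form m x.1 = 0 := hx'
      rw [mem_dodecahedron] at hx
      obtain ⟨⟨h, y⟩, e⟩ := coneMap_surjective x.1
      rw [← e] at hx hx'
      have hy := fun n hn => (form_normalVec_coneMap_nonpos_iff n h y).1 (hx n hn)
      rw [key] at hx'
      have h1 : v.1 ⬝ᵥ y = 3 * h := by
        linarith [(mul_eq_zero.1 hx').resolve_left hc.ne']
      have h2 : y = h • v.1 := by
        have h3 : (y - h • v.1) ⬝ᵥ (y - h • v.1) ≤ 0 := by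
          have h4 := dotProduct_self_le hy
          simp only [sub_dotProduct, dotProduct_sub, smul_dotProduct, dotProduct_smul, smul_eq_mul,
            hv, dotProduct_comm y v.1, h1]
          linarith
        exact sub_eq_zero.1 (dotProduct_self_eq_zero.1 (h3.antisymm (dotProduct_self_nonneg _)))
      refine Set.mem_singleton_iff.2 (H3.eq_of_eq_smul (nonneg_of_forall_dotProduct_le hy) ?_)
      rw [← e, vertex_val, ← map_smul, h2]
      simp
  · rw [Set.image_singleton, finrank_span_singleton (vertex v).ne_zero]

/-- The point is a conic combination of the `vertex v` on its supporting plane; if there were none,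
it would be the zero vector. -/
theorem exists_eq_vertex_of_isVertex {x : H3} (hx : IsVertex dodecahedron x) :
    ∃ v, vertex v = x := by
  obtain ⟨⟨m, -, hm, hxm⟩, -⟩ := hx
  have hx : x ∈ dodecahedron ∩ plane m := hxm ▸ Set.mem_singleton x
  have h := mem_pointedConeHull_of_form_eq_zero (m := m) (by
    rintro _ ⟨_, ⟨v, rfl⟩, rfl⟩
    exact hm (vertex_mem v)) (mem_pointedConeHull_vertices (mem_dodecahedron.1 hx.1)) hx.2
  by_contra! hne
  have hempty : {w ∈ (fun x : H3 => x.1) '' Set.range vertex | form m w = 0} = ∅ := by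
    refine Set.eq_empty_iff_forall_notMem.2 ?_
    rintro _ ⟨⟨_, ⟨v, rfl⟩, rfl⟩, h⟩
    have : vertex v ∈ ({x} : Set H3) := hxm ▸ ⟨vertex_mem v, h⟩
    exact hne v this
  rw [hempty] at h
  exact x.ne_zero (by simpa using h)

/-! ### Two-dimensional faces -/

/-- The face of the hyperbolic dodecahedron with outer normal `normalVec n`. -/
def facet (n : Fin 3 → ℝ) : Set H3 := dodecahedron ∩ plane (normalVec n)

theorem vertex_mem_facet_iff (v : euclVertices) (n : Fin 3 → ℝ) :
    vertex v ∈ facet n ↔ n ⬝ᵥ v.1 = φ ^ 2 := by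
  rw [← form_normalVec_coneMap_eq_zero_iff]
  exact and_iff_right (vertex_mem v)

theorem isOuterNormal_facet {n : Fin 3 → ℝ} (hn : n ∈ euclNormals) :
    IsOuterNormal dodecahedron (facet n) (normalVec n) :=
  ⟨form_normalVec_self_pos hn, fun _ hx => mem_dodecahedron.1 hx n hn, rfl⟩

theorem span_le_ker {n : Fin 4 → ℝ} {F : Set H3} (hF : F ⊆ plane n) :
    Submodule.span ℝ ((fun x : H3 => x.1) '' F) ≤ LinearMap.ker (formL n) := by
  rw [Submodule.span_le]
  rintro _ ⟨x, hx, rfl⟩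
  exact hF hx

/-- The vertices of a pentagon as points of the hyperbolic dodecahedron. -/
def IsPentagon.point {n : Fin 3 → ℝ} {p m : ZMod 5 → Fin 3 → ℝ} (h : IsPentagon n p m)
    (i : ZMod 5) : H3 := vertex ⟨p i, h.mem_vertices i⟩

section Pentagon

variable {n : Fin 3 → ℝ} {p m : ZMod 5 → Fin 3 → ℝ} (h : IsPentagon n p m)

theorem IsPentagon.point_mem_facet (i : ZMod 5) : h.point i ∈ facet n :=
  (vertex_mem_facet_iff _ _).2 (h.dotProduct_eq i)

theorem IsPentagon.form_eq_zero_iff (i j : ZMod 5) :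
    form (normalVec (m i)) (h.point j).1 = 0 ↔ j = i ∨ j = i + 1 := by
  rw [← h.neighbour_iff]
  exact form_normalVec_coneMap_eq_zero_iff _ _

theorem IsPentagon.finrank_span_facet (h : IsPentagon n p m) (hn : n ∈ euclNormals) :
    Module.finrank ℝ (Submodule.span ℝ ((fun x : H3 => x.1) '' facet n)) = 3 := by
  refine le_antisymm ?_ ?_
  · rw [← finrank_ker_formL (form_normalVec_self_pos hn)]
    exact Submodule.finrank_mono (span_le_ker Set.inter_subset_right)
  · set b : Fin 3 → Fin 4 → ℝ := ![(h.point 0).1, (h.point 1).1, (h.point 2).1] with hb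
    have hli : LinearIndependent ℝ b := by
      rw [Fintype.linearIndependent_iff]
      intro g hg
      simp only [Fin.sum_univ_three, hb, Matrix.cons_val] at hg
      -- Pairing a linear relation with the normals of neighbouring faces isolates its coefficients:
      -- sides `0` and `1` each contain two of the three points, and side `2` then settles the
      -- middle one.
      have hf (i : ZMod 5) : g 0 * form (normalVec (m i)) (h.point 0).1 +
          g 1 * form (normalVec (m i)) (h.point 1).1 +
          g 2 * form (normalVec (m i)) (h.point 2).1 = 0 := by
        rw [← form_smul_right, ← form_smul_right, ← form_smul_right, ← form_add_right,
          ← form_add_right, hg]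
        exact (formL _).map_zero
      have z (i j : ZMod 5) (hij : j = i ∨ j = i + 1) :=
        (h.form_eq_zero_iff i j).2 hij
      have nz (i j : ZMod 5) (hij : ¬(j = i ∨ j = i + 1)) :=
        mt (h.form_eq_zero_iff i j).1 hij
      have g2 : g 2 = 0 := by
        have := hf 0
        rw [z 0 0 (by decide), z 0 1 (by decide), mul_zero, mul_zero, zero_add, zero_add] at this
        exact (mul_eq_zero.1 this).resolve_right (nz 0 2 (by decide))
      have g0 : g 0 = 0 := by
        have := hf 1
        rw [z 1 1 (by decide), z 1 2 (by decide), mul_zero, mul_zero, add_zero, add_zero] at this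
        exact (mul_eq_zero.1 this).resolve_right (nz 1 0 (by decide))
      have g1 : g 1 = 0 := by
        have := hf 2
        rw [g0, g2, zero_mul, zero_mul, zero_add, add_zero] at this
        exact (mul_eq_zero.1 this).resolve_right (nz 2 1 (by decide))
      intro i
      fin_cases i
      exacts [g0, g1, g2]
    have hcard := finrank_span_eq_card hli
    rw [Fintype.card_fin] at hcard
    rw [← hcard]
    refine Submodule.finrank_mono (Submodule.span_mono ?_)
    rintro _ ⟨i, rfl⟩
    fin_cases i
    exacts [⟨_, h.point_mem_facet 0, rfl⟩, ⟨_, h.point_mem_facet 1, rfl⟩,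
      ⟨_, h.point_mem_facet 2, rfl⟩]

end Pentagon

theorem isFace_facet {n : Fin 3 → ℝ} (hn : n ∈ euclNormals) : IsFace 2 dodecahedron (facet n) := by
  obtain ⟨p, m, h⟩ := exists_isPentagon hn
  exact ⟨⟨_, isOuterNormal_facet hn⟩, h.finrank_span_facet hn⟩

/-- A set cut out by a supporting plane lies in one of the twelve facets. -/
theorem exists_subset_plane {F : Set H3} {m : Fin 4 → ℝ} (hF : IsOuterNormal dodecahedron F m) :
    ∃ n ∈ euclNormals, F ⊆ plane (normalVec n) := by
  obtain ⟨hm, hCm, rfl⟩ := hF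
  by_contra! hne
  have hlt : ∀ n ∈ euclNormals, ∃ x ∈ dodecahedron ∩ plane m, form (normalVec n) x.1 < 0 := by
    intro n hn
    obtain ⟨x, hx, hxn⟩ := Set.not_subset.1 (hne n hn)
    exact ⟨x, hx, lt_of_le_of_ne (mem_dodecahedron.1 hx.1 n hn) hxn⟩
  have : Nonempty H3 := ⟨vertex ⟨_, basePentagon_mem 0⟩⟩
  choose! x hx hxn using hlt
  set S := finite_euclNormals.toFinset
  have hS : ∀ n, n ∈ S ↔ n ∈ euclNormals := fun n => finite_euclNormals.mem_toFinset
  -- The sum stays on the plane of `m` but is strictly inside all twelve half-spaces. A small push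
  -- along `m` therefore stays in the cone while leaving the half-space of `m`, a contradiction.
  set p : Fin 4 → ℝ := ∑ n ∈ S, (x n).1
  have hsum (k : Fin 4 → ℝ) : form k p = ∑ n ∈ S, form k (x n).1 := map_sum (formL k) _ _
  have hmp : form m p = 0 := by
    rw [hsum]
    exact Finset.sum_eq_zero fun n hn => (hx n ((hS n).1 hn)).2
  have hnp : ∀ n ∈ euclNormals, form (normalVec n) p < 0 := by
    intro n hn
    rw [hsum]
    refine (Finset.sum_lt_sum (g := fun _ => (0 : ℝ))
      (fun k hk => mem_dodecahedron.1 (hx k ((hS k).1 hk)).1 n hn)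
      ⟨n, (hS n).2 hn, hxn n hn⟩).trans_eq ?_
    exact Finset.sum_const_zero
  have hev : ∀ᶠ e : ℝ in 𝓝[>] 0, ∀ n ∈ euclNormals, form (normalVec n) (p + e • m) < 0 := by
    refine (finite_euclNormals.eventually_all).2 fun n hn => ?_
    have hcont : Continuous fun e : ℝ => form (normalVec n) (p + e • m) :=
      (continuous_form_right _).comp (by fun_prop)
    refine nhdsWithin_le_nhds (hcont.continuousAt.eventually_lt continuousAt_const ?_)
    rw [zero_smul, add_zero]
    exact hnp n hn
  obtain ⟨e, he, he0⟩ := (hev.and self_mem_nhdsWithin).exists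
  have he0 : 0 < e := he0
  have hz0 : p + e • m ≠ 0 := fun h => by
    have := he _ baseNormal_mem
    rw [h] at this
    exact this.ne ((formL _).map_zero)
  obtain ⟨ht, ht0⟩ := timelike_of_forall_form_nonpos (fun n hn => (he n hn).le) hz0
  obtain ⟨y, c, hc, hy⟩ := exists_H3_eq_smul ht ht0
  have hyC : y ∈ dodecahedron := mem_dodecahedron.2 fun n hn => by
    rw [hy, form_smul_right]
    exact mul_nonpos_of_nonneg_of_nonpos hc.le (he n hn).le
  have hle : form m y.1 ≤ 0 := hCm hyC
  rw [hy, form_smul_right, form_add_right, form_smul_right, hmp, zero_add] at hle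
  exact hle.not_gt (mul_pos hc (mul_pos he0 hm))

theorem span_eq_ker {n : Fin 4 → ℝ} (hn : 0 < form n n) {F : Set H3} (hF : F ⊆ plane n)
    (h3 : Module.finrank ℝ (Submodule.span ℝ ((fun x : H3 => x.1) '' F)) = 3) :
    Submodule.span ℝ ((fun x : H3 => x.1) '' F) = LinearMap.ker (formL n) :=
  Submodule.eq_of_le_of_finrank_eq (span_le_ker hF) (by rw [h3, finrank_ker_formL hn])

/-- A span of dimension 3 determines the plane, so the supporting plane coincides with that of the
facet containing `F`. -/
theorem exists_eq_facet {F : Set H3} (hF : IsFace 2 dodecahedron F) :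
    ∃ n ∈ euclNormals, F = facet n := by
  obtain ⟨⟨m, hm⟩, h3⟩ := hF
  obtain ⟨n, hn, hFn⟩ := exists_subset_plane hm
  have hFm : F ⊆ plane m := hm.2.2 ▸ Set.inter_subset_right
  have hker := (span_eq_ker hm.1 hFm h3).symm.trans
    (span_eq_ker (form_normalVec_self_pos hn) hFn h3)
  refine ⟨n, hn, ?_⟩
  rw [hm.2.2, facet]
  congr 1
  ext x
  change x.1 ∈ LinearMap.ker (formL m) ↔ x.1 ∈ LinearMap.ker (formL (normalVec n))
  rw [hker]

/-- Distinct facets which meet have orthogonal normals. -/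
theorem dotProduct_eq_of_mem_facet {n m : Fin 3 → ℝ} (hn : n ∈ euclNormals)
    (hm : m ∈ euclNormals) (hne : n ≠ m) {x : H3} (hxn : x ∈ facet n) (hxm : x ∈ facet m) :
    n ⬝ᵥ m = φ := by
  have hn2 := dotProduct_self_of_mem_euclNormals hn
  have hm2 := dotProduct_self_of_mem_euclNormals hm
  have hφ := goldenRatio_sq
  have hφ' := goldenRatio_gt
  rcases dotProduct_cases hn hm with h | h | h
  · exact absurd (eq_of_dotProduct_eq hn2 hm2 h) hne
  · exact h
  · exfalso
    have hxC := mem_dodecahedron.1 hxn.1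
    have h1 : form (normalVec n) x.1 = 0 := hxn.2
    have h2 : form (normalVec m) x.1 = 0 := hxm.2
    have h0 := x.ne_zero
    obtain ⟨⟨t, y⟩, e⟩ := coneMap_surjective x.1
    rw [← e] at hxC h1 h2 h0
    have hy := fun n hn => (form_normalVec_coneMap_nonpos_iff n t y).1 (hxC n hn)
    have ht := nonneg_of_forall_dotProduct_le hy
    have hy2 := dotProduct_self_le hy
    rw [form_normalVec_coneMap] at h1 h2
    have h1 := (mul_eq_zero.1 h1).resolve_left sqrt_half_goldenRatio_pos.ne'
    have h2 := (mul_eq_zero.1 h2).resolve_left sqrt_half_goldenRatio_pos.ne'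
    have h3 : (n + m) ⬝ᵥ y = 2 * (φ + 1) * t := by
      rw [add_dotProduct, ← hφ]; linarith
    have h4 : (n + m) ⬝ᵥ (n + m) ≤ 4 := by
      simp only [add_dotProduct, dotProduct_add, hn2, hm2, dotProduct_comm m n]
      linarith
    have h5 := dotProduct_sq_le (n + m) y
    rw [h3] at h5
    have h6 : (2 * (φ + 1) * t) ^ 2 ≤ 12 * t ^ 2 := by
      nlinarith [dotProduct_self_nonneg y]
    have h7 : t = 0 := by
      have : t ^ 2 ≤ 0 := by nlinarith [sq_nonneg t]
      exact pow_eq_zero_iff two_ne_zero |>.1 (this.antisymm (sq_nonneg t))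
    have h8 : y = 0 := by
      rw [h7] at hy2
      exact dotProduct_self_eq_zero.1 (le_antisymm (by linarith) (dotProduct_self_nonneg y))
    exact h0 (by rw [h7, h8]; exact coneMap.map_zero)

/-- Distinct normals with the same facet would be orthogonal and have the same orthogonal
complement, so a spacelike vector would be orthogonal to itself. -/
theorem facet_injOn : Set.InjOn facet euclNormals := by
  intro n hn m hm hnm
  by_contra hne
  obtain ⟨p, q, h⟩ := exists_isPentagon hn
  have hker := (span_eq_ker (form_normalVec_self_pos hn) Set.inter_subset_right
    (h.finrank_span_facet hn)).symm.trans
    (span_eq_ker (form_normalVec_self_pos hm) (F := facet n)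
      (by rw [hnm]; exact Set.inter_subset_right)
    (h.finrank_span_facet hn))
  have horth := dotProduct_eq_of_mem_facet hn hm hne (h.point_mem_facet 0)
    (hnm ▸ h.point_mem_facet 0)
  have hmem : normalVec m ∈ LinearMap.ker (formL (normalVec n)) := by
    rw [LinearMap.mem_ker, formL_apply, form_normalVec_normalVec, horth, sub_self]
  rw [hker, LinearMap.mem_ker, formL_apply] at hmem
  exact (form_normalVec_self_pos hm).ne' hmem

theorem isConvexDodecahedron_dodecahedron : IsConvexDodecahedron dodecahedron := by
  refine ⟨isConvexPolyhedron_dodecahedron,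
    Equiv.ofBijective (fun v => ⟨vertex v, isVertex_vertex v⟩) ⟨fun v w h => ?_, fun x => ?_⟩,
    Equiv.ofBijective (fun n => ⟨facet n.1, isFace_facet n.2⟩) ⟨fun n m h => ?_, fun F => ?_⟩,
    fun v n => vertex_mem_facet_iff v n.1⟩
  · exact vertex_injective (congrArg Subtype.val h)
  · obtain ⟨v, hv⟩ := exists_eq_vertex_of_isVertex x.2
    exact ⟨v, Subtype.ext hv⟩
  · exact Subtype.ext (facet_injOn n.2 m.2 (congrArg Subtype.val h))
  · obtain ⟨n, hn, hF⟩ := exists_eq_facet F.2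
    exact ⟨⟨n, hn⟩, Subtype.ext hF.symm⟩

/-! ### The faces are right-angled regular pentagons -/

theorem isConvex_facet (n : Fin 3 → ℝ) : IsConvex (facet n) :=
  isConvex_dodecahedron.inter (isConvex_plane _)

theorem left_mem_segment (x y : H3) : x ∈ segment x y :=
  ⟨1, 0, zero_le_one, le_rfl, by simp⟩

theorem right_mem_segment (x y : H3) : y ∈ segment x y :=
  ⟨0, 1, le_rfl, zero_le_one, by simp⟩

theorem span_segment (x y : H3) :
    Submodule.span ℝ ((fun z : H3 => z.1) '' segment x y) = Submodule.span ℝ {x.1, y.1} := by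
  refine le_antisymm (Submodule.span_le.2 ?_) (Submodule.span_mono ?_)
  · rintro _ ⟨z, ⟨a, b, -, -, hz⟩, rfl⟩
    exact Submodule.mem_span_pair.2 ⟨a, b, hz.symm⟩
  · rintro _ (rfl | rfl)
    exacts [⟨x, left_mem_segment x y, rfl⟩, ⟨y, right_mem_segment x y, rfl⟩]

theorem finrank_span_segment {x y : H3} (hxy : x ≠ y) :
    Module.finrank ℝ (Submodule.span ℝ ((fun z : H3 => z.1) '' segment x y)) = 2 := by
  have hli : LinearIndependent ℝ ![x.1, y.1] := by
    rw [LinearIndependent.pair_iff' x.ne_zero]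
    intro a h
    have ha : 0 < a := by
      have h0 : a * x.1 0 = y.1 0 := congrFun h 0
      have := y.2.2
      rw [← h0] at this
      exact pos_of_mul_pos_left this x.2.2.le
    exact hxy (H3.eq_of_eq_smul ha.le h.symm).symm
  have := finrank_span_eq_card hli
  rwa [Matrix.range_cons, Matrix.range_cons, Matrix.range_empty, Set.union_empty,
    Set.singleton_union, Fintype.card_fin, ← span_segment] at this

theorem form_direction (x y z : H3) :
    form (direction x y) (direction x z) = form y.1 z.1 + form x.1 y.1 * form x.1 z.1 := by
  simp only [direction, form_add_left, form_add_right, form_smul_left, form_smul_right, x.2.1,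
    form_comm y.1 x.1]
  ring

theorem vectorAngle_eq_pi_div_two {u v : Fin 4 → ℝ} (h : form u v = 0) :
    vectorAngle u v = π / 2 := by
  rw [vectorAngle, h, zero_div, Real.arccos_zero]

section Pentagon

variable {n : Fin 3 → ℝ} {p m : ZMod 5 → Fin 3 → ℝ} (h : IsPentagon n p m)

theorem IsPentagon.point_injective : Function.Injective h.point := fun _ _ hij =>
  h.injective (congrArg Subtype.val (vertex_injective hij))

theorem IsPentagon.form_point (i j : ZMod 5) :
    form (h.point i).1 (h.point j).1 = φ / 2 * (p i ⬝ᵥ p j - (2 * φ + 1)) := by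
  rw [IsPentagon.point, IsPentagon.point, vertex_val, vertex_val, form_coneMap_coneMap, mul_one,
    mul_one]

theorem IsPentagon.form_point_succ (i : ZMod 5) :
    form (h.point i).1 (h.point (i + 1)).1 = -φ := by
  rw [h.form_point, h.dotProduct_succ]; ring

theorem IsPentagon.angleAt_eq (i : ZMod 5) :
    angleAt (h.point (i - 1)) (h.point i) (h.point (i + 1)) = π / 2 := by
  apply vectorAngle_eq_pi_div_two
  have h1 : form (h.point i).1 (h.point (i - 1)).1 = -φ := by
    have := h.form_point_succ (i - 1)
    rwa [sub_add_cancel, form_comm] at this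
  rw [form_direction, h1, h.form_point_succ, h.form_point, h.dotProduct_pred_succ]
  ring

theorem IsPentagon.mem_pointedConeHull {x : H3} (hn : n ∈ euclNormals) (hx : x ∈ facet n) :
    x.1 ∈ PointedCone.hull ℝ ((fun y : H3 => y.1) '' Set.range h.point) := by
  have hz := mem_pointedConeHull_of_form_eq_zero (m := normalVec n) (by
    rintro _ ⟨_, ⟨v, rfl⟩, rfl⟩
    exact mem_dodecahedron.1 (vertex_mem v) n hn)
    (mem_pointedConeHull_vertices (mem_dodecahedron.1 hx.1)) hx.2
  refine Submodule.span_mono ?_ hz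
  rintro _ ⟨⟨_, ⟨v, rfl⟩, rfl⟩, hv⟩
  obtain ⟨i, hi⟩ := h.mem_range v.1 v.2 ((form_normalVec_coneMap_eq_zero_iff n v.1).1 hv)
  exact ⟨_, ⟨i, congrArg vertex (Subtype.ext hi)⟩, rfl⟩

theorem IsPentagon.facet_eq_hull (hn : n ∈ euclNormals) : facet n = hull (Set.range h.point) := by
  refine Set.Subset.antisymm
    (fun x hx => mem_hull_of_mem_pointedConeHull (h.mem_pointedConeHull hn hx))
    (Set.sInter_subset_of_mem ⟨isConvex_facet n, ?_⟩)
  rintro _ ⟨i, rfl⟩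
  exact h.point_mem_facet i

/-- The neighbouring plane supports the facet and contains just two of its five vertices, so a conic
combination on it uses only those two. -/
theorem IsPentagon.segment_eq (hn : n ∈ euclNormals) (i : ZMod 5) :
    segment (h.point i) (h.point (i + 1)) = facet n ∩ plane (normalVec (m i)) := by
  refine Set.Subset.antisymm ?_ ?_
  · exact ((isConvex_facet n).inter (isConvex_plane _)) _
      ⟨h.point_mem_facet i, (h.form_eq_zero_iff i i).2 (Or.inl rfl)⟩ _
      ⟨h.point_mem_facet (i + 1), (h.form_eq_zero_iff i (i + 1)).2 (Or.inr rfl)⟩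
  · rintro x ⟨hx, hxm⟩
    have hz := mem_pointedConeHull_of_form_eq_zero (m := normalVec (m i)) (by
      rintro _ ⟨_, ⟨j, rfl⟩, rfl⟩
      exact mem_dodecahedron.1 (h.point_mem_facet j).1 _ (h.mem_normals i))
      (h.mem_pointedConeHull hn hx) hxm
    have hz' : x.1 ∈ PointedCone.hull ℝ {(h.point i).1, (h.point (i + 1)).1} := by
      refine Submodule.span_mono ?_ hz
      rintro _ ⟨⟨_, ⟨j, rfl⟩, rfl⟩, hj⟩
      rcases (h.form_eq_zero_iff i j).1 hj with rfl | rfl <;> simp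
    obtain ⟨a, b, hab⟩ := Submodule.mem_span_pair.1 hz'
    exact ⟨a, b, a.2, b.2, hab.symm⟩

theorem IsPentagon.isRegularPolygon (h : IsPentagon n p m) (hn : n ∈ euclNormals) :
    IsRegularPolygon 5 (π / 2) (facet n) := by
  refine ⟨by norm_num, h.point, h.point_injective,
    ⟨normalVec n, form_normalVec_self_pos hn, Set.inter_subset_right⟩, h.facet_eq_hull hn,
    fun i => ⟨⟨normalVec (m i), form_normalVec_self_pos (h.mem_normals i), ?_,
      h.segment_eq hn i⟩, ?_⟩, ⟨Real.arcosh φ, fun i => ?_⟩, h.angleAt_eq⟩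
  · exact fun x hx => mem_dodecahedron.1 hx.1 _ (h.mem_normals i)
  · exact finrank_span_segment (h.point_injective.ne ((by decide : ∀ i : ZMod 5, i ≠ i + 1) i))
  · rw [hdist, h.form_point_succ, neg_neg]

end Pentagon

/-! ### Dihedral angles -/

theorem hasDihedralAngle_facet {n m : Fin 3 → ℝ} (hn : n ∈ euclNormals) (hm : m ∈ euclNormals)
    (hne : n ≠ m) {x : H3} (hx : x ∈ facet n ∩ facet m) :
    HasDihedralAngle dodecahedron (facet n) (facet m) (π / 2) := by
  refine ⟨_, _, isOuterNormal_facet hn, isOuterNormal_facet hm, ?_⟩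
  rw [vectorAngle_eq_pi_div_two]
  · ring
  · rw [form_normalVec_normalVec, dotProduct_eq_of_mem_facet hn hm hne hx.1 hx.2, sub_self]

theorem IsFace.nonempty {k : ℕ} {C F : Set H3} (hF : IsFace k C F) : F.Nonempty := by
  rw [Set.nonempty_iff_ne_empty]
  rintro rfl
  have h := hF.2
  rw [Set.image_empty, Submodule.span_empty, finrank_bot] at h
  omega

end Hyp

end

theorem mainTheorem10 :
    ∃ C : Set Hyp.H3, Hyp.IsConvexDodecahedron C ∧
      (∀ F, Hyp.IsFace 2 C F → Hyp.IsRegularPolygon 5 (Real.pi / 2) F) ∧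
      (∀ F G, Hyp.IsFace 2 C F → Hyp.IsFace 2 C G → F ≠ G → Hyp.IsFace 1 C (F ∩ G) →
        Hyp.HasDihedralAngle C F G (Real.pi / 2)) := by
  refine ⟨Hyp.dodecahedron, Hyp.isConvexDodecahedron_dodecahedron, fun F hF => ?_,
    fun F G hF hG hne hFG => ?_⟩
  · obtain ⟨n, hn, rfl⟩ := Hyp.exists_eq_facet hF
    obtain ⟨p, m, h⟩ := Hyp.exists_isPentagon hn
    exact h.isRegularPolygon hn
  · obtain ⟨n, hn, rfl⟩ := Hyp.exists_eq_facet hF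
    obtain ⟨m, hm, rfl⟩ := Hyp.exists_eq_facet hG
    -- A single common point already forces the normals to be orthogonal.
    obtain ⟨x, hx⟩ := hFG.nonempty
    exact Hyp.hasDihedralAngle_facet hn hm (fun h => hne (by rw [h])) hx
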